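/- **Theorem.** Let $n \in \mathbb{N}$, let $s, t \geq 0$ with $\max(s,t) < \frac n2$, and let $0 < \alpha < s+t$. Put $f_\alpha(x) = |x|^{-\alpha}$ for $x \in \mathbb{R}^n\setminus\{0\}$ and $f_\alpha(0)=0$. Then $f_\alpha$ is locally integrable on $\mathbb{R}^n$, and the regular distribution $\mathbf{f}_\alpha(\varphi) = \int_{\mathbb{R}^n} f_\alpha(x)\varphi(x)\,dx$ belongs to the space $M[s,-t]$ of multipliers from $H^s_2(\mathbb{R}^n)$ to $H^{-t}_2(\mathbb{R}^n)$. Here, for $\gamma \in \mathbb{R}$, $H^\gamma_2(\mathbb{R}^n)$ is the Bessel potential space of all tempered distributions $u$ such that $J_\gamma u := \mathcal{F}^{-1}\bigl((1+|\xi|^2)^{\gamma/2}\,\mathcal{F}u\bigr)$ is (given by) a function in $L_2(\mathbb{R}^n)$, with norm $\|u\|_{H^\gamma_2} = \|J_\gamma u\|_{L_2}$ and $\mathcal{F}\varphi(\xi) = (2\pi)^{-n/2}\int_{\mathbb{R}^n} e^{-i\langle x,\xi\rangle}\varphi(x)\,dx$. A distribution $\mu \in D'(\mathbb{R}^n)$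 belongs to $M[s,-t]$ if $f\cdot\mu \in H^{-t}_2(\mathbb{R}^n)$ for every test function $f \in D(\mathbb{R}^n)$ (that is, $f \cdot \mu$ extends to a tempered distribution in that space) and there is a constant $C>0$ such that $$\|f\cdot\mu\|_{H^{-t}_2(\mathbb{R}^n)} \leq C\,\|f\|_{H^s_2(\mathbb{R}^n)} \qquad \text{for all } f \in D(\mathbb{R}^n),$$ where $(f\cdot\mu)(\varphi) = \mu(f\varphi)$ and a test function $f$ is identified with the regular distribution it generates. -/

import Mathlib

open MeasureTheory TopologicalSpace Set
open scoped SchwartzMap Distributions ENNReal ContDiff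

noncomputable section

namespace BesselMultiplier

/-- `ℝⁿ` with its Euclidean norm. -/
abbrev Rn (n : ℕ) : Type := EuclideanSpace ℝ (Fin n)

/-- `D(ℝⁿ)`: complex-valued smooth compactly supported functions, with the usual LF topology. -/
abbrev TestFn (n : ℕ) : Type := 𝓓((⊤ : Opens (Rn n)), ℂ)

/-- `D'(ℝⁿ)`: continuous complex-linear functionals on `D(ℝⁿ)`. -/
abbrev Distr (n : ℕ) : Type := TestFn n →L[ℂ] ℂ

/-! ### Test functions as Schwartz functions and tempered distributions as distributions -/

/-- A test function, viewed as a Schwartz function. -/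
def toSchwartz {n : ℕ} (f : TestFn n) : 𝓢(Rn n, ℂ) :=
  f.hasCompactSupport.toSchwartzMap f.contDiff

/-- The tempered distribution `φ ↦ ∫ f φ` generated by a test function `f`. -/
def toTempered {n : ℕ} (f : TestFn n) : 𝓢'(Rn n, ℂ) :=
  SchwartzMap.toTemperedDistributionCLM (Rn n) ℂ volume (toSchwartz f)

/-- The tempered distribution `u` and the distribution `T` are identified under the
usual inclusion `S'(ℝⁿ) ⊂ D'(ℝⁿ)`: they agree on all test functions. -/
def Represents {n : ℕ} (u : 𝓢'(Rn n, ℂ)) (T : Distr n) : Prop :=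
  ∀ φ : TestFn n, u (toSchwartz φ) = T φ

/-! ### Products of test functions and distributions -/

/-- Multiplication by the test function `f`, as a continuous linear map on `D(ℝⁿ)`. -/
def mulTestFn {n : ℕ} (f : TestFn n) : TestFn n →L[ℂ] TestFn n :=
  TestFunction.limitCLM ℂ
    (fun φ ↦ ⟨fun x ↦ φ x * f x, φ.contDiff.mul f.contDiff, φ.hasCompactSupport.mul_right,
      fun _ _ ↦ trivial⟩)
    (fun _K hK ↦ TestFunction.ofSupportedInCLM ℂ hK ∘L
      ContDiffMapSupportedIn.bilinLeftCLM (ContinuousLinearMap.mul ℂ ℂ) f.contDiff)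
    (fun _K _hK _φ ↦ by ext x; rfl)

/-- The product `f · μ` of a test function and a distribution: `(f · μ)(φ) = μ(f φ)`. -/
def mulDistr {n : ℕ} (f : TestFn n) (μ : Distr n) : Distr n := μ ∘L mulTestFn f

/-! ### Bessel potential spaces -/

/-- The operator `J_s u = 𝓕⁻¹((1 + |ξ|²)^(s/2) 𝓕 u)` on `S'(ℝⁿ)`, where the Fourier transform is
`𝓕 φ(ξ) = (2π)^(-n/2) ∫ e^(-i⟨x, ξ⟩) φ(x) dx`. The Fourier transform of Mathlib has the kernel
`e^(-2πi⟨x, ξ⟩)`, so in its frequency variable the symbol is `(1 + |2πξ|²)^(s/2)`;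
in both forms `J_s = (1 - Δ)^(s/2)`. -/
def besselJ (n : ℕ) (s : ℝ) : 𝓢'(Rn n, ℂ) →L[ℂ] 𝓢'(Rn n, ℂ) :=
  TemperedDistribution.fourierMultiplierCLM ℂ
    (fun ξ : Rn n ↦ (((1 + ‖(2 * Real.pi) • ξ‖ ^ 2) ^ (s / 2) : ℝ) : ℂ))

/-- The Bessel potential space `H^s_p(ℝⁿ)`: all tempered distributions `u` such that `J_s u` is
(the tempered distribution generated by) a function in `L_p`. -/
def besselSpace (n : ℕ) (s : ℝ) (p : ℝ≥0∞) [Fact (1 ≤ p)] : Set 𝓢'(Rn n, ℂ) :=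
  {u | ∃ v : Lp ℂ p (volume : Measure (Rn n)), besselJ n s u = (v : 𝓢'(Rn n, ℂ))}

/-- The norm of `H^s_p(ℝⁿ)`: the `L_p` norm of the (unique) `v ∈ L_p` with `J_s u = v`.
It is `∞` if there is no such `v`, that is, if `u` is not in the space. -/
def besselNorm (n : ℕ) (s : ℝ) (p : ℝ≥0∞) [Fact (1 ≤ p)] (u : 𝓢'(Rn n, ℂ)) : ℝ≥0∞ :=
  ⨅ (v : Lp ℂ p (volume : Measure (Rn n))) (_ : besselJ n s u = (v : 𝓢'(Rn n, ℂ))), ‖v‖ₑ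

/-- `H^s_{p, loc}(ℝⁿ)`: distributions `μ` such that `f · μ ∈ H^s_p(ℝⁿ)` for all `f ∈ D(ℝⁿ)`. -/
def besselLoc (n : ℕ) (s : ℝ) (p : ℝ≥0∞) [Fact (1 ≤ p)] : Set (Distr n) :=
  {μ | ∀ f : TestFn n, ∃ u ∈ besselSpace n s p, Represents u (mulDistr f μ)}

/-! ### Multipliers -/

/-- The space `M[H^s_p(ℝⁿ) → H^σ_r(ℝⁿ)]` of multipliers: the distributions `μ ∈ H^σ_{r, loc}(ℝⁿ)`
for which there is `C > 0` with `‖f · μ‖_{H^σ_r} ≤ C ‖f‖_{H^s_p}` for all `f ∈ D(ℝⁿ)`. -/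
def multiplierSpace (n : ℕ) (s : ℝ) (p : ℝ≥0∞) [Fact (1 ≤ p)] (σ : ℝ) (r : ℝ≥0∞)
    [Fact (1 ≤ r)] : Set (Distr n) :=
  {μ | μ ∈ besselLoc n σ r ∧
    ∃ C : ℝ, 0 < C ∧ ∀ f : TestFn n, ∃ u ∈ besselSpace n σ r, Represents u (mulDistr f μ) ∧
      besselNorm n σ r u ≤ ENNReal.ofReal C * besselNorm n s p (toTempered f)}

/-- `M[s, σ] = M[H^s_2(ℝⁿ) → H^σ_2(ℝⁿ)]`. -/
def multiplierSpaceTwo (n : ℕ) (s σ : ℝ) : Set (Distr n) := multiplierSpace n s 2 σ 2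

/-! ### The functions `f_α` -/

/-- The function `f_α(x) = |x|^(-α)` for `x ≠ 0`, `f_α(0) = 0`. -/
def fAlpha (n : ℕ) (α : ℝ) (x : Rn n) : ℂ :=
  open scoped Classical in if x = 0 then 0 else ((‖x‖ ^ (-α) : ℝ) : ℂ)

/-- The regular distribution `φ ↦ ∫ φ(x) g(x) dx` generated by a locally integrable `g`. -/
def regularDistr {n : ℕ} (g : Rn n → ℂ) : Distr n :=
  TestFunction.integralAgainstBilinCLM (ContinuousLinearMap.mul ℂ ℂ) volume g

end BesselMultiplier

end

/-! Write `α = a + b` with `a = θs`, `b = θt`, `θ = α / (s + t) < 1`. Cauchy–Schwarz bounds `∫ f_α φ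
ψ` by the product of the `L²` norms of `|x|^(-a) φ` and `|x|^(-b) ψ`, and a subcritical Hardy
inequality bounds these by the `H^s` norm of `φ` and the `H^t` norm of `ψ`. By duality (Riesz in
`L²`), `J_{-t}(f · f_α)` is then an `L²` function of norm at most a constant times the `H^s` norm of
`f`.

The Hardy inequality (`exists_lintegral_norm_rpow_mul_le`) sums over dyadic balls the local bound
`∫_{|x| ≤ r} |φ|² ≤ C r^(2s) ‖φ‖²_{H^s}` of `exists_setLIntegral_closedBall_le`; the series is
geometric and converges because `a < s`. For the local bound, frequencies are split at `1/r`: the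
low part is bounded in sup norm by Cauchy–Schwarz, where `s < n/2` makes `|ξ|^(-2s)` integrable near
the origin, and the high part is bounded in `L²` by Plancherel. -/

namespace BesselMultiplier

open Metric Module FourierTransform

/-! ### Pointwise bounds on weights, and the smooth frequency cutoff. -/

section Pointwise

variable {E : Type*} [NormedAddCommGroup E]

theorem norm_rpow_le_dyadic_sum {a : ℝ} (ha : 0 ≤ a) (x : E) :
    ENNReal.ofReal (‖x‖ ^ (-(2 * a))) ≤ 1 + ∑' j : ℕ,
      (closedBall (0 : E) (2⁻¹ ^ j)).indicator
        (fun _ ↦ ENNReal.ofReal ((2⁻¹ ^ (j + 1) : ℝ) ^ (-(2 * a)))) x := by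
  rcases (norm_nonneg x).eq_or_lt with h0 | h0
  · refine le_trans ?_ le_self_add
    rw [← h0, ← ENNReal.ofReal_one]
    refine ENNReal.ofReal_le_ofReal ?_
    -- At the origin the real power `0 ^ (-(2 * a))` is `1` for `a = 0` and `0` for `a > 0`.
    rcases ha.eq_or_lt with rfl | ha
    · simp
    · rw [Real.zero_rpow (by linarith)]
      exact zero_le_one
  rcases le_total ‖x‖ 1 with h1 | h1
  -- The shell `2^(-(j+1)) < |x| ≤ 2^(-j)` containing `x`: its single term already dominates.
  · obtain ⟨j, hj1, hj2⟩ := exists_nat_pow_near_of_lt_one h0 h1 (y := (2⁻¹ : ℝ)) (by norm_num)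
      (by norm_num)
    refine le_trans ?_ (le_add_left (ENNReal.le_tsum j))
    rw [indicator_of_mem (by simpa using hj2)]
    exact ENNReal.ofReal_le_ofReal
      (Real.rpow_le_rpow_of_nonpos (by positivity) hj1.le (by linarith))
  · refine le_trans ?_ le_self_add
    rw [← ENNReal.ofReal_one]
    exact ENNReal.ofReal_le_ofReal (Real.rpow_le_one_of_one_le_of_nonpos h1 (by linarith))

variable [InnerProductSpace ℝ E]

theorem norm_rpow_le_bessel_weight {s : ℝ} (hs : 0 ≤ s) (ξ : E) :
    ‖ξ‖ ^ (2 * s) ≤ (1 + ‖(2 * Real.pi) • ξ‖ ^ 2) ^ s := by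
  rw [Real.rpow_mul (norm_nonneg _)]
  refine Real.rpow_le_rpow (by positivity) ?_ hs
  rw [Real.rpow_two, norm_smul, mul_pow]
  have h1 : (1 : ℝ) ≤ ‖2 * Real.pi‖ ^ 2 := by
    rw [Real.norm_of_nonneg (by positivity)]
    nlinarith [Real.pi_gt_three]
  nlinarith [sq_nonneg ‖ξ‖]

theorem one_le_bessel_weight {s : ℝ} (hs : 0 ≤ s) (ξ : E) :
    1 ≤ (1 + ‖(2 * Real.pi) • ξ‖ ^ 2) ^ s :=
  Real.one_le_rpow (by nlinarith [sq_nonneg ‖(2 * Real.pi) • ξ‖]) hs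

theorem hasTemperateGrowth_bessel_symbol (s : ℝ) :
    (fun ξ : E ↦ (((1 + ‖(2 * Real.pi) • ξ‖ ^ 2) ^ (s / 2) : ℝ) : ℂ)).HasTemperateGrowth := by
  have h1 := Function.hasTemperateGrowth_one_add_norm_sq_rpow E (s / 2)
  have h2 : (fun ξ : E ↦ (2 * Real.pi) • ξ).HasTemperateGrowth := by fun_prop
  exact Function.HasTemperateGrowth.comp Function.Complex.hasTemperateGrowth_ofReal (h1.comp h2)

theorem exists_low_high_decomposition [FiniteDimensional ℝ E]
    (h : 𝓢(E, ℂ)) {R : ℝ} (hR : 0 < R) :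
    ∃ l k : 𝓢(E, ℂ), h = l + k ∧ (∀ ξ, ‖l ξ‖ ≤ ‖h ξ‖) ∧ (∀ ξ, ‖k ξ‖ ≤ ‖h ξ‖) ∧
      (∀ ξ, ξ ∉ ball (0 : E) (2 * R) → l ξ = 0) ∧ (∀ ξ, ξ ∈ closedBall (0 : E) R → k ξ = 0) := by
  let χ : ContDiffBump (0 : E) := ⟨R, 2 * R, hR, by linarith⟩
  have hχs : HasCompactSupport (fun ξ ↦ (χ ξ : ℂ)) := by
    exact χ.hasCompactSupport.comp_left (g := fun x : ℝ ↦ (x : ℂ)) Complex.ofReal_zero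
  have hχc : ContDiff ℝ ∞ (fun ξ ↦ (χ ξ : ℂ)) := Complex.ofRealCLM.contDiff.comp χ.contDiff
  have hχt : (fun ξ ↦ (χ ξ : ℂ)).HasTemperateGrowth :=
    (hχs.toSchwartzMap hχc).hasTemperateGrowth
  have hl : ∀ ξ, SchwartzMap.smulLeftCLM ℂ (fun ξ ↦ (χ ξ : ℂ)) h ξ = χ ξ * h ξ := fun ξ ↦ by
    rw [SchwartzMap.smulLeftCLM_apply_apply hχt, smul_eq_mul]
  refine ⟨SchwartzMap.smulLeftCLM ℂ (fun ξ ↦ (χ ξ : ℂ)) h,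
    h - SchwartzMap.smulLeftCLM ℂ (fun ξ ↦ (χ ξ : ℂ)) h, by abel, fun ξ ↦ ?_, fun ξ ↦ ?_,
    fun ξ hξ ↦ ?_, fun ξ hξ ↦ ?_⟩
  · rw [hl, norm_mul, Complex.norm_real, Real.norm_of_nonneg χ.nonneg]
    exact mul_le_of_le_one_left (norm_nonneg _) χ.le_one
  · rw [sub_apply, hl, ← one_sub_mul, norm_mul]
    refine mul_le_of_le_one_left (norm_nonneg _) ?_
    rw [← Complex.ofReal_one, ← Complex.ofReal_sub, Complex.norm_real,
      Real.norm_of_nonneg (by linarith [χ.le_one (x := ξ)])]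
    linarith [χ.nonneg (x := ξ)]
  · rw [hl, χ.zero_of_le_dist (by simpa using hξ)]
    simp
  · rw [sub_apply, hl, χ.one_of_mem_closedBall hξ]
    simp

end Pointwise

section Measurable

variable {E : Type*} [NormedAddCommGroup E] [InnerProductSpace ℝ E] [MeasurableSpace E]
  [BorelSpace E]

theorem measurable_bessel_weight (s : ℝ) :
    Measurable fun ξ : E ↦ ENNReal.ofReal ((1 + ‖(2 * Real.pi) • ξ‖ ^ 2) ^ s) := by
  fun_prop

end Measurable

/-! ### The subcritical Hardy inequality. -/

section Hardy

variable {E : Type*} [NormedAddCommGroup E] [InnerProductSpace ℝ E] [FiniteDimensional ℝ E]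
  [MeasurableSpace E] [BorelSpace E]

/-- The squared `L²` norm of `h` with respect to the Bessel weight of order `s`. -/
noncomputable def besselEnergy (s : ℝ) (h : E → ℂ) : ℝ≥0∞ :=
  ∫⁻ ξ, ENNReal.ofReal ((1 + ‖(2 * Real.pi) • ξ‖ ^ 2) ^ s) * ‖h ξ‖ₑ ^ 2

/-- Change of variables `x ↦ ρ x`; as an identity in `ℝ≥0∞` it needs no convergence. -/
theorem setLIntegral_ball_norm_rpow (β : ℝ) {ρ : ℝ} (hρ : 0 < ρ) :
    ∫⁻ x in ball (0 : E) ρ, ENNReal.ofReal (‖x‖ ^ (-β)) =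
      ENNReal.ofReal (ρ ^ ((finrank ℝ E : ℝ) - β)) *
        ∫⁻ x in ball (0 : E) 1, ENNReal.ofReal (‖x‖ ^ (-β)) := by
  have hmap := Measure.map_addHaar_smul (volume : Measure E) hρ.ne'
  have hmeas : Measurable ((ball (0 : E) ρ).indicator fun x ↦ ENNReal.ofReal (‖x‖ ^ (-β))) :=
    Measurable.indicator (by fun_prop) measurableSet_ball
  have hpos : 0 < ρ ^ finrank ℝ E := by positivity
  have key := lintegral_map (μ := (volume : Measure E)) hmeas (measurable_const_smul ρ)
  rw [hmap, lintegral_smul_measure, lintegral_indicator measurableSet_ball,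
    abs_of_pos (by positivity)] at key
  have hscale : ∀ x : E, (ball (0 : E) ρ).indicator (fun x ↦ ENNReal.ofReal (‖x‖ ^ (-β))) (ρ • x)
      = ENNReal.ofReal (ρ ^ (-β)) *
        (ball (0 : E) 1).indicator (fun x ↦ ENNReal.ofReal (‖x‖ ^ (-β))) x := by
    intro x
    have hn : ‖ρ • x‖ = ρ * ‖x‖ := by rw [norm_smul, Real.norm_of_nonneg hρ.le]
    by_cases hx : ‖x‖ < 1
    · rw [indicator_of_mem, indicator_of_mem, hn, Real.mul_rpow hρ.le (norm_nonneg _),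
        ENNReal.ofReal_mul (by positivity)]
      · simpa using hx
      · rw [mem_ball_zero_iff, hn]; nlinarith
    · rw [indicator_of_notMem, indicator_of_notMem, mul_zero]
      · simpa using hx
      · rw [mem_ball_zero_iff, hn]; nlinarith
  simp_rw [hscale] at key
  rw [lintegral_const_mul _ (Measurable.indicator (by fun_prop) measurableSet_ball),
    lintegral_indicator measurableSet_ball, smul_eq_mul] at key
  have h2 : ENNReal.ofReal (ρ ^ finrank ℝ E) * ENNReal.ofReal (ρ ^ finrank ℝ E)⁻¹ = 1 := by
    rw [← ENNReal.ofReal_mul hpos.le, mul_inv_cancel₀ hpos.ne', ENNReal.ofReal_one]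
  rw [sub_eq_add_neg, Real.rpow_add hρ, Real.rpow_natCast, ENNReal.ofReal_mul hpos.le, mul_assoc,
    ← key, ← mul_assoc, h2, one_mul]

theorem setLIntegral_unitBall_norm_rpow_lt_top (hd : 1 ≤ finrank ℝ E) {β : ℝ}
    (hβ : β < finrank ℝ E) :
    ∫⁻ x in ball (0 : E) 1, ENNReal.ofReal (‖x‖ ^ (-β)) < ⊤ := by
  have h : IntegrableOn (fun x : E ↦ ‖x‖ ^ (-β)) (ball 0 1) volume :=
    integrableOn_ball_of_norm_le_rpow hd (C := 1) hβ
      (Filter.Eventually.of_forall fun x ↦ by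
        rw [Real.norm_of_nonneg (by positivity), one_mul]) (by
          apply Measurable.aestronglyMeasurable; fun_prop)
  exact (hasFiniteIntegral_iff_ofReal (Filter.Eventually.of_forall fun x ↦ by
    simp only [Pi.zero_apply]; positivity)).1 h.2

theorem lintegral_sq_mul_le {f g : E → ℝ≥0∞} (hf : AEMeasurable f) (hg : AEMeasurable g) :
    (∫⁻ x, f x * g x) ^ 2 ≤ (∫⁻ x, f x ^ 2) * ∫⁻ x, g x ^ 2 := by
  have h := ENNReal.lintegral_mul_le_Lp_mul_Lq volume Real.HolderConjugate.two_two hf hg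
  simp only [Pi.mul_apply, ENNReal.rpow_two] at h
  calc _ ≤ _ := pow_le_pow_left' h 2
    _ = _ := by
      rw [mul_pow, ← ENNReal.rpow_natCast, ← ENNReal.rpow_natCast, ← ENNReal.rpow_mul,
        ← ENNReal.rpow_mul]
      norm_num

/-- Cauchy–Schwarz against the Bessel weight, for functions supported in a ball. -/
theorem sq_lintegral_le_besselEnergy (s : ℝ) (hs : 0 ≤ s) {h : E → ℂ} (hh : Measurable h)
    (hd : 1 ≤ finrank ℝ E) {ρ : ℝ} (hρ : 0 < ρ) (hsupp : ∀ ξ, ξ ∉ ball (0 : E) ρ → h ξ = 0) :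
    (∫⁻ ξ, ‖h ξ‖ₑ) ^ 2 ≤ ENNReal.ofReal (ρ ^ ((finrank ℝ E : ℝ) - 2 * s)) *
        (∫⁻ x in ball (0 : E) 1, ENNReal.ofReal (‖x‖ ^ (-(2 * s)))) * besselEnergy s h := by
  have : Nontrivial E := Module.nontrivial_of_finrank_pos (R := ℝ) (by omega)
  set W : E → ℝ≥0∞ := fun ξ ↦ ENNReal.ofReal ((1 + ‖(2 * Real.pi) • ξ‖ ^ 2) ^ (s / 2)) with hW
  set V : E → ℝ≥0∞ := fun ξ ↦ (ball (0 : E) ρ).indicator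
    (fun x ↦ ENNReal.ofReal (‖x‖ ^ (-s))) ξ with hV
  have hWm : Measurable W := measurable_bessel_weight _
  have hVm : Measurable V := Measurable.indicator (by fun_prop) measurableSet_ball
  have h1 : ∫⁻ ξ, ‖h ξ‖ₑ ≤ ∫⁻ ξ, V ξ * (W ξ * ‖h ξ‖ₑ) := by
    -- The bound `1 ≤ V * W` can fail at the origin, where `‖0‖ ^ (-s) = 0` for `s > 0`.
    have hne : ∀ᵐ ξ : E, ξ ≠ 0 := by
      simp [ae_iff]
    refine lintegral_mono_ae ?_
    filter_upwards [hne] with ξ hξ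
    by_cases hb : ξ ∈ ball (0 : E) ρ
    · rw [← mul_assoc]
      refine le_mul_of_one_le_left zero_le ?_
      simp only [hV, hW, indicator_of_mem hb]
      rw [← ENNReal.ofReal_mul (by positivity), ENNReal.one_le_ofReal,
        Real.rpow_neg (norm_nonneg _)]
      have := norm_rpow_le_bessel_weight (s := s / 2) (by linarith) ξ
      rw [show 2 * (s / 2) = s by ring] at this
      have hp : 0 < ‖ξ‖ ^ s := by positivity
      rw [inv_mul_eq_div, le_div_iff₀ hp]
      linarith
    · simp [hsupp ξ hb]
  have h2 := lintegral_sq_mul_le hVm.aemeasurable (hWm.mul hh.enorm).aemeasurable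
  refine (pow_le_pow_left' h1 2).trans (h2.trans ?_)
  rw [← setLIntegral_ball_norm_rpow _ hρ, ← lintegral_indicator measurableSet_ball]
  refine mul_le_mul' (lintegral_mono fun x ↦ ?_) (lintegral_mono fun x ↦ ?_)
  · by_cases hb : x ∈ ball (0 : E) ρ
    · simp only [hV, indicator_of_mem hb]
      rw [← ENNReal.ofReal_pow (by positivity), ← Real.rpow_natCast, ← Real.rpow_mul (by positivity)]
      refine le_of_eq ?_
      congr 2; push_cast; ring
    · simp [hV, hb]
  · simp only [hW, Pi.mul_apply]
    rw [mul_pow, ← ENNReal.ofReal_pow (by positivity), ← Real.rpow_natCast,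
      ← Real.rpow_mul (by positivity)]
    refine le_of_eq ?_
    congr 3; push_cast; ring

/-- High frequencies are controlled by the Bessel energy. -/
theorem lintegral_sq_le_besselEnergy (s : ℝ) (hs : 0 ≤ s) (h : E → ℂ)
    {R : ℝ} (hR : 0 < R) (hsupp : ∀ ξ, ξ ∈ closedBall (0 : E) R → h ξ = 0) :
    ∫⁻ ξ, ‖h ξ‖ₑ ^ 2 ≤ ENNReal.ofReal (R ^ (-(2 * s))) * besselEnergy s h := by
  rw [besselEnergy, ← lintegral_const_mul' _ _ ENNReal.ofReal_ne_top]
  refine lintegral_mono fun ξ ↦ ?_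
  by_cases hb : ξ ∈ closedBall (0 : E) R
  · simp [hsupp ξ hb]
  · rw [← mul_assoc]
    refine le_mul_of_one_le_left zero_le ?_
    rw [← ENNReal.ofReal_mul (by positivity), ENNReal.one_le_ofReal, Real.rpow_neg hR.le,
      inv_mul_eq_div, le_div_iff₀ (by positivity), one_mul]
    rw [mem_closedBall_zero_iff, not_le] at hb
    exact (Real.rpow_le_rpow hR.le hb.le (by linarith)).trans (norm_rpow_le_bessel_weight hs ξ)

theorem besselEnergy_mono {s : ℝ} {h k : E → ℂ} (hk : ∀ ξ, ‖h ξ‖ ≤ ‖k ξ‖) :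
    besselEnergy s h ≤ besselEnergy s k :=
  lintegral_mono fun ξ ↦ by
    have : ‖h ξ‖ₑ ≤ ‖k ξ‖ₑ := by simpa [enorm_le_iff_norm_le] using hk ξ
    simp only
    gcongr

/-- A linear operator on Schwartz functions with the two mapping properties of the Fourier
transform: `L¹ → L^∞` and `L² → L²` with norm at most one. -/
structure IsFourierLike (T : 𝓢(E, ℂ) →ₗ[ℂ] 𝓢(E, ℂ)) : Prop where
  enorm_le : ∀ h x, ‖T h x‖ₑ ≤ ∫⁻ ξ, ‖h ξ‖ₑ
  lintegral_le : ∀ h, ∫⁻ x, ‖T h x‖ₑ ^ 2 ≤ ∫⁻ ξ, ‖h ξ‖ₑ ^ 2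

/-- Local estimate on small balls, of the order predicted by scaling. -/
theorem exists_setLIntegral_closedBall_le {s : ℝ} (hs : 0 ≤ s) (hsd : s < finrank ℝ E / 2) :
    ∃ C : ℝ≥0∞, C ≠ ⊤ ∧ ∀ T : 𝓢(E, ℂ) →ₗ[ℂ] 𝓢(E, ℂ), IsFourierLike T →
      ∀ (h : 𝓢(E, ℂ)) (r : ℝ), 0 < r →
        ∫⁻ x in closedBall (0 : E) r, ‖T h x‖ₑ ^ 2 ≤
          C * ENNReal.ofReal (r ^ (2 * s)) * besselEnergy s h := by
  have hd : 1 ≤ finrank ℝ E := by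
    by_contra! h0
    have : finrank ℝ E = 0 := by omega
    rw [this] at hsd
    norm_num at hsd
    linarith
  set d := finrank ℝ E with hd'
  set I := ∫⁻ x in ball (0 : E) 1, ENNReal.ofReal (‖x‖ ^ (-(2 * s))) with hI
  have hIfin : I ≠ ⊤ :=
    (setLIntegral_unitBall_norm_rpow_lt_top hd (by rw [← hd']; linarith)).ne
  -- The outer `2` comes from `(x + y)² ≤ 2x² + 2y²`, the first summand from low frequencies and the
  -- `1` from high ones.
  refine ⟨2 * (volume (ball (0 : E) 1) * ENNReal.ofReal (2 ^ ((d : ℝ) - 2 * s)) * I + 1), ?_, ?_⟩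
  · have : volume (ball (0 : E) 1) ≠ ⊤ := measure_ball_lt_top.ne
    finiteness
  intro T hT h r hr
  -- The cutoff `1/r` balances the two parts: both then contribute order `r^(2s)`.
  obtain ⟨l, k, rfl, hl, hk, hls, hks⟩ := exists_low_high_decomposition h (inv_pos.2 hr)
  set N := besselEnergy s ⇑(l + k)
  have hlow : ∫⁻ x in closedBall (0 : E) r, ‖T l x‖ₑ ^ 2 ≤
      volume (ball (0 : E) 1) * ENNReal.ofReal (2 ^ ((d : ℝ) - 2 * s)) * I *
        ENNReal.ofReal (r ^ (2 * s)) * N := by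
    have h1 := sq_lintegral_le_besselEnergy s hs l.continuous.measurable hd
      (mul_pos two_pos (inv_pos.2 hr)) hls
    calc ∫⁻ x in closedBall (0 : E) r, ‖T l x‖ₑ ^ 2
        ≤ ∫⁻ _x in closedBall (0 : E) r, (∫⁻ ξ, ‖l ξ‖ₑ) ^ 2 :=
          lintegral_mono fun x ↦ pow_le_pow_left' (hT.enorm_le l x) 2
      _ = (∫⁻ ξ, ‖l ξ‖ₑ) ^ 2 * volume (closedBall (0 : E) r) := setLIntegral_const _ _
      _ ≤ (ENNReal.ofReal ((2 * r⁻¹) ^ ((d : ℝ) - 2 * s)) * I * N) *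
          (ENNReal.ofReal (r ^ d) * volume (ball (0 : E) 1)) := by
        rw [Measure.addHaar_closedBall _ _ hr.le]
        gcongr
        exact h1.trans (mul_le_mul' le_rfl (besselEnergy_mono hl))
      _ = _ := by
        have : ENNReal.ofReal ((2 * r⁻¹) ^ ((d : ℝ) - 2 * s)) * ENNReal.ofReal (r ^ d) =
            ENNReal.ofReal (2 ^ ((d : ℝ) - 2 * s)) * ENNReal.ofReal (r ^ (2 * s)) := by
          rw [← ENNReal.ofReal_mul (by positivity), ← ENNReal.ofReal_mul (by positivity),
            Real.mul_rpow two_pos.le (by positivity), mul_assoc, Real.inv_rpow hr.le,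
            ← Real.rpow_neg hr.le, ← Real.rpow_natCast, ← Real.rpow_add hr]
          congr 3; ring
        calc _ = (ENNReal.ofReal ((2 * r⁻¹) ^ ((d : ℝ) - 2 * s)) * ENNReal.ofReal (r ^ d)) *
              (I * N * volume (ball (0 : E) 1)) := by ring
          _ = _ := by rw [this]; ring
  have hhigh : ∫⁻ x in closedBall (0 : E) r, ‖T k x‖ₑ ^ 2 ≤ ENNReal.ofReal (r ^ (2 * s)) * N := by
    calc ∫⁻ x in closedBall (0 : E) r, ‖T k x‖ₑ ^ 2 ≤ ∫⁻ x, ‖T k x‖ₑ ^ 2 :=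
          setLIntegral_le_lintegral _ _
      _ ≤ ∫⁻ ξ, ‖k ξ‖ₑ ^ 2 := hT.lintegral_le k
      _ ≤ _ := lintegral_sq_le_besselEnergy s hs k (inv_pos.2 hr) hks
      _ ≤ _ := by
        rw [Real.inv_rpow hr.le, Real.rpow_neg hr.le, inv_inv]
        exact mul_le_mul' le_rfl (besselEnergy_mono hk)
  calc ∫⁻ x in closedBall (0 : E) r, ‖T (l + k) x‖ₑ ^ 2
      ≤ ∫⁻ x in closedBall (0 : E) r, (2 * ‖T l x‖ₑ ^ 2 + 2 * ‖T k x‖ₑ ^ 2) := by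
        refine lintegral_mono fun x ↦ ?_
        rw [map_add, add_apply]
        have h1 := ENNReal.rpow_add_le_mul_rpow_add_rpow ‖T l x‖ₑ ‖T k x‖ₑ (p := 2) one_le_two
        norm_num at h1
        refine (pow_le_pow_left' (enorm_add_le _ _) 2).trans (h1.trans_eq (by ring))
    _ = 2 * (∫⁻ x in closedBall (0 : E) r, ‖T l x‖ₑ ^ 2) +
          2 * ∫⁻ x in closedBall (0 : E) r, ‖T k x‖ₑ ^ 2 := by
        rw [lintegral_add_left, lintegral_const_mul' _ _ (by simp),
          lintegral_const_mul' _ _ (by simp)]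
        exact ((T l).continuous.measurable.enorm.pow_const 2).const_mul 2
    _ ≤ _ := by
        refine (add_le_add (mul_le_mul' le_rfl hlow) (mul_le_mul' le_rfl hhigh)).trans_eq ?_
        ring

/-- A subcritical Hardy inequality. -/
theorem exists_lintegral_norm_rpow_mul_le {a s : ℝ} (ha : 0 ≤ a) (has : a < s ∨ a = 0)
    (hs : 0 ≤ s) (hsd : s < finrank ℝ E / 2) :
    ∃ C : ℝ≥0∞, C ≠ ⊤ ∧ ∀ T : 𝓢(E, ℂ) →ₗ[ℂ] 𝓢(E, ℂ), IsFourierLike T → ∀ h : 𝓢(E, ℂ),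
      ∫⁻ x, ENNReal.ofReal (‖x‖ ^ (-(2 * a))) * ‖T h x‖ₑ ^ 2 ≤ C * besselEnergy s h := by
  have hL2 : ∀ T : 𝓢(E, ℂ) →ₗ[ℂ] 𝓢(E, ℂ), IsFourierLike T → ∀ h : 𝓢(E, ℂ),
      ∫⁻ x, ‖T h x‖ₑ ^ 2 ≤ besselEnergy s h := fun T hT h ↦
    (hT.lintegral_le h).trans (lintegral_mono fun ξ ↦
      le_mul_of_one_le_left zero_le (ENNReal.one_le_ofReal.2 (one_le_bessel_weight hs ξ)))
  -- For `a = 0` the weight is `1` and Plancherel suffices; this covers `s = 0`, where no `a < s` is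
  -- available.
  rcases has with has | rfl
  swap
  · exact ⟨1, ENNReal.one_ne_top, fun T hT h ↦ by simpa using hL2 T hT h⟩
  obtain ⟨C, hC, hCT⟩ := exists_setLIntegral_closedBall_le hs hsd
  set c : ℕ → ℝ≥0∞ := fun j ↦ ENNReal.ofReal ((2⁻¹ ^ (j + 1) : ℝ) ^ (-(2 * a))) with hc
  -- Ratio of the dyadic series, less than `1` exactly because `a < s`.
  set q : ℝ := 2⁻¹ ^ (2 * (s - a)) with hq
  have hq0 : 0 ≤ q := by positivity
  have hq1 : q < 1 := Real.rpow_lt_one (by norm_num) (by norm_num) (by linarith)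
  have hcj : ∀ j, c j * ENNReal.ofReal ((2⁻¹ ^ j : ℝ) ^ (2 * s)) =
      ENNReal.ofReal (2⁻¹ ^ (-(2 * a))) * ENNReal.ofReal q ^ j := by
    intro j
    rw [hc, ← ENNReal.ofReal_pow hq0, ← ENNReal.ofReal_mul (by positivity),
      ← ENNReal.ofReal_mul (by positivity), hq]
    congr 1
    simp only [← Real.rpow_natCast, ← Real.rpow_mul (show (0 : ℝ) ≤ 2⁻¹ by norm_num)]
    rw [← Real.rpow_add (by norm_num), ← Real.rpow_add (by norm_num)]
    congr 1; push_cast; ring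
  refine ⟨1 + C * ENNReal.ofReal (2⁻¹ ^ (-(2 * a))) * (1 - ENNReal.ofReal q)⁻¹, ?_, ?_⟩
  · have : 1 - ENNReal.ofReal q ≠ 0 := by
      rw [← ENNReal.ofReal_one, ← ENNReal.ofReal_sub _ hq0]
      simpa using hq1
    finiteness
  intro T hT h
  have hm : Measurable fun x ↦ ‖T h x‖ₑ ^ 2 := (T h).continuous.measurable.enorm.pow_const 2
  calc ∫⁻ x, ENNReal.ofReal (‖x‖ ^ (-(2 * a))) * ‖T h x‖ₑ ^ 2
      ≤ ∫⁻ x, (‖T h x‖ₑ ^ 2 + ∑' j : ℕ,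
          c j * (closedBall (0 : E) (2⁻¹ ^ j)).indicator (fun x ↦ ‖T h x‖ₑ ^ 2) x) := by
        refine lintegral_mono fun x ↦ ?_
        refine (mul_le_mul' (norm_rpow_le_dyadic_sum ha x) le_rfl).trans_eq ?_
        rw [add_mul, one_mul, ← ENNReal.tsum_mul_right]
        congr 2
        ext j
        by_cases hx : x ∈ closedBall (0 : E) (2⁻¹ ^ j)
        · simp only [indicator_of_mem hx, hc]
        · simp only [indicator_of_notMem hx, zero_mul, mul_zero]
    _ = (∫⁻ x, ‖T h x‖ₑ ^ 2) +
          ∑' j : ℕ, c j * ∫⁻ x in closedBall (0 : E) (2⁻¹ ^ j), ‖T h x‖ₑ ^ 2 := by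
        rw [lintegral_add_left hm, lintegral_tsum]
        · congr 1
          refine tsum_congr fun j ↦ ?_
          rw [lintegral_const_mul' _ _ ENNReal.ofReal_ne_top,
            lintegral_indicator measurableSet_closedBall]
        · exact fun j ↦ ((hm.indicator measurableSet_closedBall).const_mul _).aemeasurable
    _ ≤ besselEnergy s h +
          ∑' j : ℕ, c j * (C * ENNReal.ofReal ((2⁻¹ ^ j : ℝ) ^ (2 * s)) * besselEnergy s h) :=
        add_le_add (hL2 T hT h) (ENNReal.tsum_le_tsum fun j ↦
          mul_le_mul' le_rfl (hCT T hT h _ (by positivity)))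
    _ = _ := by
        rw [add_mul, one_mul, ← ENNReal.tsum_geometric, ← ENNReal.tsum_mul_left,
          ← ENNReal.tsum_mul_right]
        congr 1
        refine tsum_congr fun j ↦ ?_
        calc _ = (c j * ENNReal.ofReal ((2⁻¹ ^ j : ℝ) ^ (2 * s))) * (C * besselEnergy s h) := by ring
          _ = _ := by rw [hcj j]; ring

theorem lintegral_sq_fourier (h : 𝓢(E, ℂ)) : ∫⁻ x, ‖𝓕 h x‖ₑ ^ 2 = ∫⁻ x, ‖h x‖ₑ ^ 2 := by
  have key := SchwartzMap.integral_norm_sq_fourier h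
  have hint : ∀ g : 𝓢(E, ℂ), ∫⁻ x, ‖g x‖ₑ ^ 2 = ENNReal.ofReal (∫ x, ‖g x‖ ^ 2) := fun g ↦ by
    rw [ofReal_integral_eq_lintegral_ofReal
      ((memLp_two_iff_integrable_sq_norm (g.memLp 2 volume).1).1 (g.memLp 2 volume))
      (Filter.Eventually.of_forall fun x ↦ by simp only [Pi.zero_apply]; positivity)]
    simp_rw [ENNReal.ofReal_pow (norm_nonneg _), ofReal_norm]
  rw [hint, hint, key]

theorem isFourierLike_fourier : IsFourierLike (fourierCLM ℂ 𝓢(E, ℂ)).toLinearMap where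
  enorm_le h x := by
    simp only [ContinuousLinearMap.coe_coe, fourierCLM_apply, SchwartzMap.fourier_coe]
    rw [Real.fourier_eq]
    refine (enorm_integral_le_lintegral_enorm _).trans_eq ?_
    exact lintegral_congr fun ξ ↦ by rw [← ofReal_norm, Circle.norm_smul, ofReal_norm]
  lintegral_le h := (lintegral_sq_fourier h).le

theorem isFourierLike_fourierInv : IsFourierLike (fourierInvCLM ℂ 𝓢(E, ℂ)).toLinearMap where
  enorm_le h x := by
    simp only [ContinuousLinearMap.coe_coe, fourierInvCLM_apply, SchwartzMap.fourierInv_coe]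
    rw [Real.fourierInv_eq]
    refine (enorm_integral_le_lintegral_enorm _).trans_eq ?_
    exact lintegral_congr fun ξ ↦ by rw [← ofReal_norm, Circle.norm_smul, ofReal_norm]
  lintegral_le h := by
    have := lintegral_sq_fourier (𝓕⁻ h)
    rw [FourierTransform.fourier_fourierInv_eq] at this
    exact this.ge

end Hardy

/-! ### Plancherel with Bessel weights, and `L²` duality. -/

section Duality

variable {E : Type*} [NormedAddCommGroup E] [InnerProductSpace ℝ E] [FiniteDimensional ℝ E]
  [MeasurableSpace E] [BorelSpace E]

theorem enorm_toLp_two_sq (g : 𝓢(E, ℂ)) :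
    ‖g.toLp 2 (volume : Measure E)‖ₑ ^ 2 = ∫⁻ x, ‖g x‖ₑ ^ 2 := by
  rw [Lp.enorm_def, eLpNorm_congr_ae (g.coeFn_toLp 2 volume),
    eLpNorm_eq_lintegral_rpow_enorm_toReal two_ne_zero ENNReal.ofNat_ne_top]
  simp only [ENNReal.toReal_ofNat, ENNReal.rpow_two]
  rw [← ENNReal.rpow_natCast, ← ENNReal.rpow_mul]
  norm_num

theorem lintegral_sq_smulLeft_eq_besselEnergy (s : ℝ) (h : 𝓢(E, ℂ)) :
    ∫⁻ ξ, ‖SchwartzMap.smulLeftCLM ℂ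
      (fun ξ : E ↦ (((1 + ‖(2 * Real.pi) • ξ‖ ^ 2) ^ (s / 2) : ℝ) : ℂ)) h ξ‖ₑ ^ 2 =
      besselEnergy s h := by
  refine lintegral_congr fun ξ ↦ ?_
  rw [SchwartzMap.smulLeftCLM_apply_apply (hasTemperateGrowth_bessel_symbol s), smul_eq_mul,
    enorm_mul, mul_pow, ← ofReal_norm (Complex.ofReal _), Complex.norm_real,
    Real.norm_of_nonneg (by positivity), ← ENNReal.ofReal_pow (by positivity),
    ← Real.rpow_natCast, ← Real.rpow_mul (by positivity)]
  congr 3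
  push_cast
  ring

theorem besselEnergy_smulLeft_neg (s : ℝ) (h : 𝓢(E, ℂ)) :
    besselEnergy s (SchwartzMap.smulLeftCLM ℂ
      (fun ξ : E ↦ (((1 + ‖(2 * Real.pi) • ξ‖ ^ 2) ^ (-s / 2) : ℝ) : ℂ)) h) =
      ∫⁻ ξ, ‖h ξ‖ₑ ^ 2 := by
  rw [← lintegral_sq_smulLeft_eq_besselEnergy]
  refine lintegral_congr fun ξ ↦ ?_
  rw [SchwartzMap.smulLeftCLM_apply_apply (hasTemperateGrowth_bessel_symbol s),
    SchwartzMap.smulLeftCLM_apply_apply (hasTemperateGrowth_bessel_symbol (-s)), smul_smul,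
    ← Complex.ofReal_mul, ← Real.rpow_add (by positivity), neg_div, add_neg_cancel, Real.rpow_zero,
    Complex.ofReal_one, one_smul]

/-- A tempered distribution that is bounded for the `L²` norm is given by an `L²` function. -/
theorem exists_Lp_two_of_bound (w : 𝓢'(E, ℂ)) {A : ℝ} (hA : 0 ≤ A)
    (hw : ∀ g : 𝓢(E, ℂ), ‖w g‖ ≤ A * ‖g.toLp 2 (volume : Measure E)‖) :
    ∃ v : Lp ℂ 2 (volume : Measure E), w = (v : 𝓢'(E, ℂ)) ∧ ‖v‖ ≤ A := by
  let e : 𝓢(E, ℂ) →ₗ[ℂ] Lp ℂ 2 (volume : Measure E) :=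
    (SchwartzMap.toLpCLM ℂ ℂ 2 (volume : Measure E)).toLinearMap
  let w' : 𝓢(E, ℂ) →ₗ[ℂ] ℂ :=
    { toFun := fun g ↦ w g
      map_add' := fun g k ↦ map_add w g k
      map_smul' := fun c g ↦ map_smul w c g }
  have hde : DenseRange e := SchwartzMap.denseRange_toLpCLM ENNReal.ofNat_ne_top
  have hw' : ∀ g, ‖w' g‖ ≤ A * ‖e g‖ := hw
  let L : Lp ℂ 2 (volume : Measure E) →L[ℂ] ℂ := w'.extendOfNorm e
  have hL : ∀ g, L (e g) = w g := LinearMap.extendOfNorm_eq hde ⟨A, hw'⟩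
  have hLn : ‖L‖ ≤ A := LinearMap.opNorm_extendOfNorm_le hde hA hw'
  let v := (InnerProductSpace.toDual ℂ (Lp ℂ 2 (volume : Measure E))).symm L
  -- The inner product is conjugate-linear in `v`, while the pairing with a distribution is
  -- bilinear, hence the conjugate.
  refine ⟨star v, ?_, ?_⟩
  · ext g
    rw [Lp.toTemperedDistribution_apply, ← hL g,
      ← InnerProductSpace.toDual_symm_apply (𝕜 := ℂ) (y := L), L2.inner_def]
    refine integral_congr_ae ?_
    filter_upwards [Lp.coeFn_star v, g.coeFn_toLp 2 volume] with x h1 h2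
    rw [h1]
    change inner ℂ (v x) ((g.toLp 2 volume : E → ℂ) x) = _
    rw [h2]
    simp
  · have h1 : ‖star v‖ = ‖v‖ := by
      rw [Lp.norm_def, Lp.norm_def, eLpNorm_congr_ae (Lp.coeFn_star v)]
      congr 1
      exact eLpNorm_congr_norm_ae (Filter.Eventually.of_forall fun x ↦ by simp)
    rw [h1, LinearIsometryEquiv.norm_map]
    exact hLn

end Duality

/-! ### The multiplier estimate for `f_α`. -/

variable {n : ℕ}

/-- The Bessel norm of a test function is the square root of its Bessel energy. -/
theorem enorm_sq_eq_besselEnergy (s : ℝ) (f : TestFn n)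
    (v : Lp ℂ 2 (volume : Measure (Rn n))) (hv : besselJ n s (toTempered f) = (v : 𝓢'(Rn n, ℂ))) :
    ‖v‖ₑ ^ 2 = besselEnergy s (𝓕 (toSchwartz f) : 𝓢(Rn n, ℂ)) := by
  set g := SchwartzMap.fourierMultiplierCLM ℂ
    (fun ξ : Rn n ↦ (((1 + ‖(2 * Real.pi) • ξ‖ ^ 2) ^ (s / 2) : ℝ) : ℂ)) (toSchwartz f) with hg
  have h1 : besselJ n s (toTempered f) =
      ((g.toLp 2 (volume : Measure (Rn n)) : Lp ℂ 2 (volume : Measure (Rn n))) :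
        𝓢'(Rn n, ℂ)) := by
    rw [Lp.toTemperedDistribution_toLp_eq, besselJ, toTempered,
      TemperedDistribution.fourierMultiplierCLM_toTemperedDistributionCLM_eq
        (hasTemperateGrowth_bessel_symbol s)]
  have h2 : v = g.toLp 2 (volume : Measure (Rn n)) :=
    LinearMap.ker_eq_bot.1 (Lp.ker_toTemperedDistributionCLM_eq_bot (F := ℂ)
      (μ := (volume : Measure (Rn n))) (p := 2)) (hv.symm.trans h1)
  subst h2
  rw [enorm_toLp_two_sq, ← lintegral_sq_fourier, hg, SchwartzMap.fourierMultiplierCLM_apply,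
    FourierTransform.fourier_fourierInv_eq, lintegral_sq_smulLeft_eq_besselEnergy]

theorem besselEnergy_lt_top (s : ℝ) (h : 𝓢(Rn n, ℂ)) : besselEnergy s h < ⊤ := by
  rw [← lintegral_sq_smulLeft_eq_besselEnergy, ← enorm_toLp_two_sq]
  finiteness

theorem norm_fAlpha_le {α : ℝ} (x : Rn n) : ‖fAlpha n α x‖ ≤ ‖x‖ ^ (-α) := by
  unfold fAlpha
  split_ifs with h
  · rw [norm_zero]; positivity
  · rw [Complex.norm_real, Real.norm_of_nonneg (by positivity)]

theorem measurable_fAlpha (α : ℝ) : Measurable (fAlpha n α) := by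
  unfold fAlpha
  exact Measurable.ite (measurableSet_singleton 0) measurable_const (by fun_prop)

theorem locallyIntegrable_fAlpha {α : ℝ} (hn : 1 ≤ n) (hα : α < n) :
    LocallyIntegrable (fAlpha n α) :=
  locallyIntegrable_of_norm_le_rpow (C := 1) (α := α) (by simpa using hn) (by simpa using hα)
    (Filter.Eventually.of_forall fun x ↦ by simpa using norm_fAlpha_le x)
    (measurable_fAlpha α).aestronglyMeasurable

theorem enorm_sq_integral_fAlpha_le (a b : ℝ) {φ ψ : Rn n → ℂ} (hφ : Measurable φ)
    (hψ : Measurable ψ) :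
    ‖∫ x, ψ x * (fAlpha n (a + b) x * φ x)‖ₑ ^ 2 ≤
      (∫⁻ x, ENNReal.ofReal (‖x‖ ^ (-(2 * a))) * ‖φ x‖ₑ ^ 2) *
        ∫⁻ x, ENNReal.ofReal (‖x‖ ^ (-(2 * b))) * ‖ψ x‖ₑ ^ 2 := by
  have hsq : ∀ (c : ℝ) (k : Rn n → ℂ) (x : Rn n),
      (ENNReal.ofReal (‖x‖ ^ (-c)) * ‖k x‖ₑ) ^ 2 =
        ENNReal.ofReal (‖x‖ ^ (-(2 * c))) * ‖k x‖ₑ ^ 2 := fun c k x ↦ by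
    rw [mul_pow, ← ENNReal.ofReal_pow (by positivity), ← Real.rpow_natCast,
      ← Real.rpow_mul (norm_nonneg _)]
    congr 3; push_cast; ring
  simp_rw [← hsq]
  refine le_trans ?_ (lintegral_sq_mul_le (Measurable.aemeasurable (by fun_prop))
    (Measurable.aemeasurable (by fun_prop)))
  refine pow_le_pow_left' ((enorm_integral_le_lintegral_enorm _).trans
    (lintegral_mono fun x ↦ ?_)) 2
  have hf : ‖fAlpha n (a + b) x‖ₑ ≤
      ENNReal.ofReal (‖x‖ ^ (-a)) * ENNReal.ofReal (‖x‖ ^ (-b)) := by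
    by_cases hx : x = 0
    · simp [fAlpha, hx]
    · rw [← ENNReal.ofReal_mul (by positivity), ← Real.rpow_add (norm_pos_iff.2 hx), ← ofReal_norm]
      refine ENNReal.ofReal_le_ofReal ((norm_fAlpha_le x).trans_eq ?_)
      congr 1; ring
  rw [enorm_mul, enorm_mul]
  calc _ ≤ ‖ψ x‖ₑ * (ENNReal.ofReal (‖x‖ ^ (-a)) * ENNReal.ofReal (‖x‖ ^ (-b)) * ‖φ x‖ₑ) := by
        gcongr
    _ = _ := by ring

/-- The bilinear estimate behind the multiplier property. -/
theorem exists_enorm_sq_integral_fAlpha_le {a b s t : ℝ} (ha : 0 ≤ a) (has : a < s ∨ a = 0)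
    (hs : 0 ≤ s) (hsn : s < n / 2) (hb : 0 ≤ b) (hbt : b < t ∨ b = 0) (ht : 0 ≤ t)
    (htn : t < n / 2) :
    ∃ C : ℝ≥0∞, C ≠ ⊤ ∧ ∀ φ h : 𝓢(Rn n, ℂ),
      ‖∫ x, 𝓕 h x * (fAlpha n (a + b) x * φ x)‖ₑ ^ 2 ≤
        C * besselEnergy s (𝓕 φ : 𝓢(Rn n, ℂ)) * besselEnergy t h := by
  obtain ⟨C₁, hC₁, h₁⟩ := exists_lintegral_norm_rpow_mul_le (E := Rn n) ha has hs (by simpa using hsn)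
  obtain ⟨C₂, hC₂, h₂⟩ := exists_lintegral_norm_rpow_mul_le (E := Rn n) hb hbt ht (by simpa using htn)
  refine ⟨C₁ * C₂, ENNReal.mul_ne_top hC₁ hC₂, fun φ h ↦ ?_⟩
  refine (enorm_sq_integral_fAlpha_le a b φ.continuous.measurable
    (𝓕 h).continuous.measurable).trans ?_
  -- `φ` is recovered as the inverse transform of `𝓕 φ`, whereas `𝓕 h` uses the forward one; hence
  -- the Hardy inequality for a general `T`.
  have h₁' := h₁ _ isFourierLike_fourierInv (𝓕 φ)
  simp only [ContinuousLinearMap.coe_coe, fourierInvCLM_apply,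
    FourierTransform.fourierInv_fourier_eq] at h₁'
  exact (mul_le_mul' h₁' (h₂ _ isFourierLike_fourier h)).trans_eq (by ring)

/-- Duality turns the bilinear bound into the multiplier bound. The `+ 1` makes the constant
strictly positive. -/
theorem exists_represents_mulDistr {α s t : ℝ} (hα : LocallyIntegrable (fAlpha n α)) {C : ℝ≥0∞}
    (hC : C ≠ ⊤) (hCb : ∀ φ h : 𝓢(Rn n, ℂ), ‖∫ x, 𝓕 h x * (fAlpha n α x * φ x)‖ₑ ^ 2 ≤
      C * besselEnergy s (𝓕 φ : 𝓢(Rn n, ℂ)) * besselEnergy t h) (f : TestFn n) :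
    ∃ u ∈ besselSpace n (-t) 2, Represents u (mulDistr f (regularDistr (fAlpha n α))) ∧
      besselNorm n (-t) 2 u ≤ ENNReal.ofReal ((C ^ (2⁻¹ : ℝ)).toReal + 1) *
        besselNorm n s 2 (toTempered f) := by
  have hint : Integrable (fun x ↦ fAlpha n α x * f x) := by
    simpa only [smul_eq_mul, mul_comm] using
      hα.integrable_smul_left_of_hasCompactSupport f.contDiff.continuous f.hasCompactSupport
  set u : 𝓢'(Rn n, ℂ) := Lp.toTemperedDistribution
    ((memLp_one_iff_integrable.2 hint).toLp (fun x ↦ fAlpha n α x * f x)) with hu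
  have huapp : ∀ g : 𝓢(Rn n, ℂ), u g = ∫ x, g x * (fAlpha n α x * f x) := fun g ↦ by
    rw [hu, Lp.toTemperedDistribution_apply]
    refine integral_congr_ae ?_
    filter_upwards [(memLp_one_iff_integrable.2 hint).coeFn_toLp] with x hx
    rw [hx, smul_eq_mul]
  set N := besselEnergy s (𝓕 (toSchwartz f) : 𝓢(Rn n, ℂ)) with hN
  have hNfin : N ≠ ⊤ := (besselEnergy_lt_top s _).ne
  set A : ℝ≥0∞ := (C * N) ^ (2⁻¹ : ℝ) with hA
  have hAfin : A ≠ ⊤ := ENNReal.rpow_ne_top_of_nonneg (by norm_num) (by finiteness)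
  have hA2 : A ^ 2 = C * N := by
    rw [hA, ← ENNReal.rpow_natCast, ← ENNReal.rpow_mul]
    norm_num
  obtain ⟨v, hv, hvA⟩ := exists_Lp_two_of_bound (besselJ n (-t) u) (A := A.toReal)
    ENNReal.toReal_nonneg (fun g ↦ by
      -- With this `h`, `𝓕 h` is `J_{-t}` transposed onto `g`, and the energy of `h` of order `t` is
      -- `‖g‖²` in `L²`.
      have h1 := hCb (toSchwartz f) (SchwartzMap.smulLeftCLM ℂ
        (fun ξ : Rn n ↦ (((1 + ‖(2 * Real.pi) • ξ‖ ^ 2) ^ (-t / 2) : ℝ) : ℂ)) (𝓕⁻ g))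
      rw [besselEnergy_smulLeft_neg, ← lintegral_sq_fourier,
        FourierTransform.fourier_fourierInv_eq, ← enorm_toLp_two_sq, ← hN, ← hA2, ← mul_pow] at h1
      have h2 := (ENNReal.pow_le_pow_left_iff two_ne_zero).1 h1
      rw [besselJ, TemperedDistribution.fourierMultiplierCLM_apply_apply, huapp]
      have h3 := ENNReal.toReal_mono (by finiteness) h2
      rwa [ENNReal.toReal_mul, toReal_enorm, toReal_enorm] at h3)
  refine ⟨u, ⟨v, hv⟩, fun φ ↦ ?_, ?_⟩
  · rw [huapp, mulDistr, ContinuousLinearMap.comp_apply, regularDistr,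
      TestFunction.integralAgainstBilinCLM_eq_integral (hα.locallyIntegrableOn _)]
    refine integral_congr_ae (Filter.Eventually.of_forall fun x ↦ ?_)
    change φ x * (fAlpha n α x * f x) = (φ x * f x) * fAlpha n α x
    ring
  · calc besselNorm n (-t) 2 u ≤ ‖v‖ₑ := iInf₂_le v hv
      _ ≤ A := by
        rw [← ENNReal.toReal_le_toReal (by finiteness) hAfin, toReal_enorm]
        exact hvA
      _ = C ^ (2⁻¹ : ℝ) * N ^ (2⁻¹ : ℝ) := ENNReal.mul_rpow_of_nonneg _ _ (by norm_num)
      _ ≤ _ := by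
        gcongr
        · rw [ENNReal.ofReal_add ENNReal.toReal_nonneg zero_le_one, ENNReal.ofReal_toReal
            (ENNReal.rpow_ne_top_of_nonneg (by norm_num) hC)]
          exact le_self_add
        · refine le_iInf₂ fun w hw ↦ ?_
          rw [hN, ← enorm_sq_eq_besselEnergy s f w hw, ← ENNReal.rpow_natCast, ← ENNReal.rpow_mul]
          norm_num

end BesselMultiplier

theorem theorem1 (n : ℕ) (s t : ℝ) (hs : 0 ≤ s) (ht : 0 ≤ t) (hst : max s t < (n : ℝ) / 2)
    (α : ℝ) (hα : α ∈ Set.Ioo 0 (s + t)) :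
    LocallyIntegrable (BesselMultiplier.fAlpha n α) ∧
      BesselMultiplier.regularDistr (BesselMultiplier.fAlpha n α) ∈
        BesselMultiplier.multiplierSpaceTwo n s (-t) := by
  obtain ⟨hα0, hα1⟩ := hα
  obtain ⟨hsn, htn⟩ := max_lt_iff.1 hst
  have hn : 1 ≤ n := by
    by_contra! h
    obtain rfl : n = 0 := by omega
    norm_num at hsn
    linarith
  have hloc := BesselMultiplier.locallyIntegrable_fAlpha (n := n) hn
    (show α < n by linarith)
  have hst0 : 0 < s + t := hα0.trans hα1
  have hθ0 : 0 ≤ α / (s + t) := by positivity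
  have hθ1 : α / (s + t) < 1 := (div_lt_one hst0).2 hα1
  -- Since `θ < 1`, `θr < r` unless `r = 0`; one of `s`, `t` may vanish.
  have hpart : ∀ r : ℝ, 0 ≤ r → α / (s + t) * r < r ∨ α / (s + t) * r = 0 := fun r hr ↦ by
    rcases hr.eq_or_lt with rfl | hr
    · simp
    · exact Or.inl (by nlinarith)
  obtain ⟨C, hC, hCb⟩ := BesselMultiplier.exists_enorm_sq_integral_fAlpha_le (n := n)
    (mul_nonneg hθ0 hs) (hpart s hs) hs hsn (mul_nonneg hθ0 ht) (hpart t ht) ht htn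
  rw [← mul_add, div_mul_cancel₀ _ hst0.ne'] at hCb
  have key := BesselMultiplier.exists_represents_mulDistr hloc hC hCb
  exact ⟨hloc, fun f ↦ (key f).imp fun u hu ↦ ⟨hu.1, hu.2.1⟩,
    _, add_pos_of_nonneg_of_pos ENNReal.toReal_nonneg one_pos, key⟩
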